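/- Consider a distributed control system with agents (states) $\mathcal X=\{x_1,\dots,x_n\}$ and observers $\mathcal Y=\{y_1,\dots,y_m\}$, described by a directed graph with edge set $\mathcal E=\mathcal E_{\mathcal X,\mathcal X}\cup\mathcal E_{\mathcal X,\mathcal Y}$, where $\mathcal E_{\mathcal X,\mathcal X}\subseteq\mathcal X\times\mathcal X$ and $\mathcal E_{\mathcal X,\mathcal Y}\subseteq\mathcal X\times\mathcal Y$. Every agent has a self loop, each observer measures exactly one agent (has exactly one incoming edge), and no two observers measure the same agent. An agent is called unobserved if it has no edge to an observer. Let $p\ge 0$ be an integer with $m\ge p$. A feasible attack is a set $F\subseteq\mathcal X$ of compromised agents with $|F|\le p$; let $\mathcal F_x$ be the set of all feasible attacks. Given $F=\{x_{i_1},\dots,x_{i_{p'}}\}$, the attacked system has inputs $u_1,\dots,u_{p'}$, with $u_l$ entering exactly the agent $x_{i_l}$, and is $$x(k+1)=Ax(k)+B^a u(k),\qquad y(k)=Cx(k),$$ where the entries of $A\in\mathbb R^{n\times n}$, $B^a\in\mathbb R^{n\times p'}$, $C\in\mathbb R^{m\times n}$ are free real parameters at the positions $A_{ji}$ with $(x_i,x_j)\in\mathcal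 E$, $B^a_{i_l l}$, and $C_{ji}$ with $(x_i,y_j)\in\mathcal E$, and are fixed to be $0$ at all other positions. A realization $(A,B^a,C)$ is left invertible if, with $x(0)=0$, $y(k)=0$ for all $k\ge 0$ implies $u(k)=0$ for all $k\ge 0$. The structural system $([A],[B^a],[C])$ is structurally left invertible if all its realizations are left invertible, except for a set of values of the free parameters of Lebesgue measure $0$. Let $\mathcal G'$ be the directed graph with vertex set $\mathcal X\cup\{o\}$ obtained by collapsing all observers to a single node $o$ (and having no attack inputs): its edges are those of $\mathcal E_{\mathcal X,\mathcal X}$ together with $(x_i,o)$ for each observed agent $x_i$. For distinct nonadjacent vertices $a,b$, meaning that $(a,b)$ is not an edge, a vertex separator of $(a,b)$ is a set $S$ of vertices with $a,b\notin S$ whose removal removes all directed paths from $a$ to $b$. Then $([A],[B^a],[C])$ is structurally left invertible for every feasible attack $F\in\mathcal F_x$ if and only if, for each unobserved agent $x_i$, every vertex separator $S_i$ of $(x_i,o)$ in $\mathcal G'$ satisfies $|S_i|\ge p$. -/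

import Mathlib

open Matrix MeasureTheory

/-! ### Linear systems and left invertibility -/

/-- The system `x(k+1) = A x(k) + B u(k)`, `y(k) = C x(k) + D u(k)` is left invertible if, with
`x(0) = 0`, a vanishing output sequence forces a vanishing input sequence. -/
def LeftInvertible {X U Y : Type} [Fintype X] [Fintype U]
    (A : Matrix X X ℝ) (B : Matrix X U ℝ) (C : Matrix Y X ℝ) (D : Matrix Y U ℝ) : Prop :=
  ∀ (x : ℕ → X → ℝ) (u : ℕ → U → ℝ),
    x 0 = 0 →
    (∀ k, x (k + 1) = A *ᵥ x k + B *ᵥ u k) →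
    (∀ k, C *ᵥ x k + D *ᵥ u k = 0) →
    ∀ k, u k = 0

/-! ### Structural systems -/

/-- The positions of the free entries of a structural matrix `M`: the proposition `M i j` says
that the entry `(i, j)` is a free parameter, and its negation that the entry is fixed to be 0. -/
abbrev FreeEntry {I J : Type} (M : Matrix I J Prop) : Type :=
  {e : I × J // M e.1 e.2}

open Classical in
/-- The numerical matrix with structure `M` and values `θ` of its free entries. -/
noncomputable def realize {I J : Type} (M : Matrix I J Prop) (θ : FreeEntry M → ℝ) :
    Matrix I J ℝ :=
  Matrix.of fun i j => if h : M i j then θ ⟨(i, j), h⟩ else 0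

/-- A structural system `([A], [B], [C], [D])` with state, input and output nodes `X`, `U`, `Y`. -/
structure StructuralSystem (X U Y : Type) where
  A : Matrix X X Prop
  B : Matrix X U Prop
  C : Matrix Y X Prop
  D : Matrix Y U Prop

namespace StructuralSystem

/-- The free parameters of a structural system. -/
abbrev Parameter {X U Y : Type} (S : StructuralSystem X U Y) : Type :=
  FreeEntry S.A ⊕ FreeEntry S.B ⊕ FreeEntry S.C ⊕ FreeEntry S.D

/-- The realization of a structural system at parameter values `θ` is left invertible. -/
def RealizationLeftInvertible {X U Y : Type} [Fintype X] [Fintype U]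
    (S : StructuralSystem X U Y) (θ : S.Parameter → ℝ) : Prop :=
  LeftInvertible
    (realize S.A fun e => θ (.inl e))
    (realize S.B fun e => θ (.inr (.inl e)))
    (realize S.C fun e => θ (.inr (.inr (.inl e))))
    (realize S.D fun e => θ (.inr (.inr (.inr e))))

open Classical in
/-- A structural system is structurally left invertible if all its realizations are left
invertible, except for a set of parameter values of Lebesgue measure zero. -/
def StructurallyLeftInvertible {X U Y : Type} [Fintype X] [Fintype U] [Fintype Y]
    (S : StructuralSystem X U Y) : Prop :=
  ∀ᵐ θ : S.Parameter → ℝ ∂volume, S.RealizationLeftInvertible θ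

end StructuralSystem

/-! ### Distributed control systems under attack -/

/-- A network of `n` agents `x_i` and `m` observers `y_j`. `comm i j` is the edge `(x_i, x_j)`,
and `obs i j` is the edge `(x_i, y_j)`. Every agent has a self loop, every observer measures
exactly one agent, and no two observers measure the same agent. -/
structure Network (n m : ℕ) where
  comm : Fin n → Fin n → Prop
  obs : Fin n → Fin m → Prop
  self_loop : ∀ i, comm i i
  obs_unique : ∀ j, ∃! i, obs i j
  obs_dedicated : ∀ i j j', obs i j → obs i j' → j = j'

namespace Network

/-- The structural system `([A], [B^a], [C], [D^a])`, `D^a = 0`, of the network when the agents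
in `F` are compromised. There is one attack input for each element of `F`, which is fed to
exactly that agent. -/
def attackedSystem {n m : ℕ} (N : Network n m) (F : Finset (Fin n)) :
    StructuralSystem (Fin n) F (Fin m) where
  A := Matrix.of fun j i => N.comm i j
  B := Matrix.of fun i u => i = (u : Fin n)
  C := Matrix.of fun j i => N.obs i j
  D := Matrix.of fun _ _ => False

/-- Agent `x_i` is unobserved. -/
def Unobserved {n m : ℕ} (N : Network n m) (i : Fin n) : Prop :=
  ∀ j, ¬ N.obs i j

/-- The graph obtained from the graph of the attacked system by removing the attack inputs and
collapsing all observers to one node `o`. Here `some i` is the agent `x_i`, and `none` is `o`. -/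
def collapsedGraph {n m : ℕ} (N : Network n m) : Digraph (Option (Fin n)) where
  Adj a b :=
    match a, b with
    | some i, some j => N.comm i j
    | some i, none => ∃ j, N.obs i j
    | none, _ => False

end Network

/-- The feasible attacks on agents: sets of at most `p` compromised agents. -/
def feasibleStateAttacks (n p : ℕ) : Set (Finset (Fin n)) :=
  {F | F.card ≤ p}

/-! ### Vertex separators -/

/-- The list `l` of vertices is a path from `a` to `b` in the directed graph `G`. -/
def IsDipath {V : Type} (G : Digraph V) (a b : V) (l : List V) : Prop :=
  l.head? = some a ∧ l.getLast? = some b ∧ l.IsChain G.Adj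

/-- `S` is a vertex separator of the distinct nonadjacent vertices `(a, b)` in `G`: a set of
vertices other than `a` and `b` whose removal removes all paths from `a` to `b`. -/
def IsVertexSeparator {V : Type} (G : Digraph V) (a b : V) (S : Finset V) : Prop :=
  a ≠ b ∧ ¬ G.Adj a b ∧ a ∉ S ∧ b ∉ S ∧ ∀ l, IsDipath G a b l → ∃ v ∈ l, v ∈ S

/-! ### Zero sets of polynomials -/

/-! Sufficiency is a matching problem. If the columns of the pencil `[I - A, -B; C, D]` can be
matched injectively to rows along its free pattern, some parameters turn the matched square
submatrix into the identity. Its determinant is then a nonzero polynomial in the parameters, so it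
is nonzero almost everywhere, and this forces left invertibility. A failure of Hall's condition for
the matching produces fewer than `p` agents separating some unobserved agent from `o`
(`exists_matching`). Necessity holds for every realization, not just generically. If `T` separates
`x_i` from `o` and has fewer than `p` elements, attacking `x_i` and `T` is feasible. Either some
attack gain vanishes, or a pulse at `x_i` is confined by cancellation on `T` to unobserved agents
(`not_realizationLeftInvertible`). -/

theorem MvPolynomial.ae_eval_ne_zero_fin {n : ℕ} (q : MvPolynomial (Fin n) ℝ) (hq : q ≠ 0) :
    ∀ᵐ x : Fin n → ℝ, MvPolynomial.eval x q ≠ 0 := by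
  induction n with
  | zero =>
    refine Filter.Eventually.of_forall fun x hx => hq ?_
    refine MvPolynomial.funext fun y => ?_
    rw [Subsingleton.elim y x, hx, map_zero]
  | succ n ih =>
    have hq' : MvPolynomial.finSuccEquiv ℝ n q ≠ 0 := by simpa using hq
    -- Fubini: where the leading coefficient in the first variable is nonzero, the remaining
    -- univariate polynomial has finitely many roots.
    have hlead := ih _ (Polynomial.leadingCoeff_ne_zero.mpr hq')
    have hmeas : MeasurableSet {z : (Fin n → ℝ) × ℝ |
        MvPolynomial.eval (Fin.cons z.2 z.1 : Fin (n + 1) → ℝ) q ≠ 0} := by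
      have hc : Continuous fun z : (Fin n → ℝ) × ℝ =>
          MvPolynomial.eval (Fin.cons z.2 z.1 : Fin (n + 1) → ℝ) q :=
        (MvPolynomial.continuous_eval q).comp
          (continuous_pi fun i => by refine Fin.cases ?_ (fun j => ?_) i <;> simp <;> fun_prop)
      exact (isOpen_ne.preimage hc).measurableSet
    have hprod : ∀ᵐ z : (Fin n → ℝ) × ℝ,
        MvPolynomial.eval (Fin.cons z.2 z.1 : Fin (n + 1) → ℝ) q ≠ 0 := by
      rw [Measure.volume_eq_prod, Measure.ae_prod_iff_ae_ae hmeas]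
      filter_upwards [hlead] with y hy
      set r : Polynomial ℝ :=
        Polynomial.map (MvPolynomial.eval y) (MvPolynomial.finSuccEquiv ℝ n q) with hr
      have hr0 : r ≠ 0 := fun h => hy (by
        have := congrArg (fun s => s.coeff (MvPolynomial.finSuccEquiv ℝ n q).natDegree) h
        simpa [hr, Polynomial.coeff_map] using this)
      have hfin : {t : ℝ | ¬ r.eval t ≠ 0}.Finite := by
        simpa [Polynomial.IsRoot] using Polynomial.finite_setOfPred_isRoot hr0
      have : ∀ᵐ t : ℝ, r.eval t ≠ 0 := hfin.measure_zero volume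
      filter_upwards [this] with t ht
      simpa [MvPolynomial.eval_eq_eval_mv_eval'] using ht
    have hmp := (Measure.measurePreserving_swap (μ := (volume : Measure ℝ))
      (ν := (volume : Measure (Fin n → ℝ)))).comp
      (volume_preserving_piFinSuccAbove (fun _ : Fin (n + 1) => ℝ) 0)
    filter_upwards [hmp.quasiMeasurePreserving.ae hprod] with x hx
    simpa [MeasurableEquiv.piFinSuccAbove, Fin.insertNthEquiv, Fin.cons_self_tail] using hx

theorem MvPolynomial.ae_eval_ne_zero {σ : Type*} [Fintype σ] (q : MvPolynomial σ ℝ)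
    (hq : q ≠ 0) : ∀ᵐ x : σ → ℝ, MvPolynomial.eval x q ≠ 0 := by
  let e := Fintype.equivFin σ
  have hq' : MvPolynomial.rename e q ≠ 0 := fun h =>
    hq (MvPolynomial.rename_injective e e.injective (by simpa using h))
  have hmp := volume_measurePreserving_piCongrLeft (fun _ : Fin (Fintype.card σ) => ℝ) e
  filter_upwards [hmp.quasiMeasurePreserving.ae
    (MvPolynomial.ae_eval_ne_zero_fin _ hq')] with x hx
  rw [MvPolynomial.eval_rename] at hx
  convert hx using 3
  funext i
  exact (MeasurableEquiv.piCongrLeft_apply_apply (β := fun _ => ℝ) e x i).symm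

/-- If the entries of a square matrix are polynomials in real parameters and its determinant is
nonzero for one choice of the parameters, it is nonzero for almost every choice. -/
theorem ae_det_ne_zero_of_polynomial_entries {σ ι : Type*} [Fintype σ] [Fintype ι] [DecidableEq ι]
    (M : (σ → ℝ) → Matrix ι ι ℝ)
    (hM : ∀ i j, ∃ q : MvPolynomial σ ℝ, ∀ θ, MvPolynomial.eval θ q = M θ i j)
    (θ₀ : σ → ℝ) (h₀ : (M θ₀).det ≠ 0) : ∀ᵐ θ, (M θ).det ≠ 0 := by
  choose Q hQ using hM
  have heval : ∀ θ, MvPolynomial.eval θ (Matrix.of Q).det = (M θ).det := fun θ => by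
    rw [RingHom.map_det]
    congr 1
    ext i j
    exact hQ i j θ
  have hne : (Matrix.of Q).det ≠ 0 := fun h => h₀ (by rw [← heval, h, map_zero])
  filter_upwards [MvPolynomial.ae_eval_ne_zero _ hne] with θ hθ
  rwa [← heval]

/-! ### A determinantal criterion for left invertibility -/

/-- The system pencil `[I - tA, -tB; C, D]`. -/
noncomputable def systemPencil {X U Y : Type} [DecidableEq X]
    (A : Matrix X X ℝ) (B : Matrix X U ℝ) (C : Matrix Y X ℝ) (D : Matrix Y U ℝ) :
    Matrix (X ⊕ Y) (X ⊕ U) (Polynomial ℝ) :=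
  Matrix.fromBlocks (1 - (Polynomial.X : Polynomial ℝ) • A.map Polynomial.C)
    (-((Polynomial.X : Polynomial ℝ) • B.map Polynomial.C))
    (C.map Polynomial.C) (D.map Polynomial.C)

theorem systemPencil_map_eval_one {X U Y : Type} [DecidableEq X]
    (A : Matrix X X ℝ) (B : Matrix X U ℝ) (C : Matrix Y X ℝ) (D : Matrix Y U ℝ) :
    (systemPencil A B C D).map (Polynomial.eval 1) = Matrix.fromBlocks (1 - A) (-B) C D := by
  ext (i | i) (j | j) <;> simp [systemPencil, Matrix.one_apply]
  split_ifs <;> simp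

/-- The hypothesis is the value at `t = 1` of a minor of the pencil, so that minor is nonzero in
`ℝ[t]`, hence in `ℝ⟦t⟧`. The generating functions of state and input lie in the kernel of the pencil
over the domain `ℝ⟦t⟧`, so they vanish. -/
theorem leftInvertible_of_det_ne_zero {X U Y : Type} [Fintype X] [Fintype U] [DecidableEq X]
    [DecidableEq U]
    (A : Matrix X X ℝ) (B : Matrix X U ℝ) (C : Matrix Y X ℝ) (D : Matrix Y U ℝ)
    (g : X ⊕ U → X ⊕ Y)
    (hdet : ((Matrix.fromBlocks (1 - A) (-B) C D).submatrix g id).det ≠ 0) :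
    LeftInvertible A B C D := by
  intro x u hx0 hx hy
  let φ : Polynomial ℝ →+* PowerSeries ℝ := Polynomial.coeToPowerSeries.ringHom
  have hpoly : ((systemPencil A B C D).submatrix g id).det ≠ 0 := fun h => hdet (by
    rw [← systemPencil_map_eval_one]
    have := congrArg (Polynomial.evalRingHom (1 : ℝ)) h
    rwa [RingHom.map_det, map_zero] at this)
  have hps : (((systemPencil A B C D).map φ).submatrix g id).det ≠ 0 := by
    have h := RingHom.map_det φ ((systemPencil A B C D).submatrix g id)
    exact fun h' => hpoly (Polynomial.coe_injective ℝ (by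
      simpa [φ] using h.trans h'))
  let v : X ⊕ U → PowerSeries ℝ := Sum.elim (fun i => PowerSeries.mk fun k => x k i)
    (fun j => PowerSeries.mk fun k => u k j)
  have hker : ((systemPencil A B C D).map φ) *ᵥ v = 0 := by
    funext r
    ext k
    rcases r with i | i
    · have hone : ∀ j, φ ((1 : Matrix X X (Polynomial ℝ)) i j) = if i = j then 1 else 0 :=
        fun j => by rw [Matrix.one_apply]; split_ifs <;> simp
      have key : (((systemPencil A B C D).map φ) *ᵥ v) (.inl i) =
          PowerSeries.mk (fun k => x k i) - PowerSeries.X *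
            ((∑ j, PowerSeries.C (A i j) * PowerSeries.mk (fun k => x k j)) +
              ∑ j, PowerSeries.C (B i j) * PowerSeries.mk (fun k => u k j)) := by
        have hX : φ Polynomial.X = PowerSeries.X := Polynomial.coe_X
        have hCc : ∀ a, φ (Polynomial.C a) = PowerSeries.C a := fun a => Polynomial.coe_C a
        simp [Matrix.mulVec, dotProduct, systemPencil, v, hone, sub_mul, mul_add,
          Finset.mul_sum, mul_assoc, hX, hCc, ← sub_eq_add_neg, sub_sub, mul_left_comm]
      rw [key]
      -- The constant term is where `x 0 = 0` is needed; coefficient `k + 1` is the state equation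
      -- at time `k`.
      cases k with
      | zero => simp [hx0]
      | succ k =>
        have := congrFun (hx k) i
        simp only [Pi.add_apply, Matrix.mulVec, dotProduct] at this
        simp [PowerSeries.coeff_succ_X_mul, this]
    · have := congrFun (hy k) i
      simp only [Pi.add_apply, Matrix.mulVec, dotProduct] at this
      simpa [Matrix.mulVec, dotProduct, systemPencil, v, φ] using this
  have hv := Matrix.eq_zero_of_mulVec_eq_zero hps (v := v) (by
    funext r
    exact congrFun hker (g r))
  intro k
  funext j
  have := congrArg (PowerSeries.coeff k) (congrFun hv (.inr j))
  simpa [v] using this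

namespace Network

variable {n m : ℕ} (N : Network n m)

/-! ### Sufficiency -/

/-- The nonzero pattern of the system pencil of the attacked system: `N.pencilPattern F c r` says
that the column `c` may have a nonzero entry in the row `r`. -/
def pencilPattern (F : Finset (Fin n)) : Fin n ⊕ F → Fin n ⊕ Fin m → Prop
  | .inl i, .inl j => N.comm i j
  | .inl i, .inr j => N.obs i j
  | .inr u, .inl j => j = (u : Fin n)
  | .inr _, .inr _ => False

theorem structurallyLeftInvertible_of_matching (F : Finset (Fin n))
    (g : Fin n ⊕ F → Fin n ⊕ Fin m) (hg : Function.Injective g)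
    (hpat : ∀ c, N.pencilPattern F c (g c)) :
    (N.attackedSystem F).StructurallyLeftInvertible := by
  classical
  unfold StructuralSystem.StructurallyLeftInvertible
  let S := N.attackedSystem F
  let M : (S.Parameter → ℝ) → Matrix (Fin n ⊕ F) (Fin n ⊕ F) ℝ := fun θ =>
    (Matrix.fromBlocks (1 - realize S.A fun e => θ (.inl e))
      (-(realize S.B fun e => θ (.inr (.inl e))))
      (realize S.C fun e => θ (.inr (.inr (.inl e))))
      (realize S.D fun e => θ (.inr (.inr (.inr e))))).submatrix g id
  let E : Fin n ⊕ Fin m → Fin n ⊕ F → ℝ := fun r c => if r = g c then 1 else 0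
  have hE : ∀ r c, ¬ N.pencilPattern F c r → E r c = 0 := fun r c h =>
    if_neg fun hr : r = g c => h (hr ▸ hpat c)
  -- These values solve `[I - A, -B; C, D] = E` entry by entry. Self loops make every diagonal entry
  -- of `A` free, so the `1`s of `I` can be cancelled.
  let θ₀ : S.Parameter → ℝ
    | .inl e => (1 : Matrix (Fin n) (Fin n) ℝ) e.1.1 e.1.2 - E (.inl e.1.1) (.inl e.1.2)
    | .inr (.inl e) => -E (.inl e.1.1) (.inr e.1.2)
    | .inr (.inr (.inl e)) => E (.inr e.1.1) (.inl e.1.2)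
    | .inr (.inr (.inr _)) => 0
  have hblocks : Matrix.fromBlocks (1 - realize S.A fun e => θ₀ (.inl e))
      (-(realize S.B fun e => θ₀ (.inr (.inl e))))
      (realize S.C fun e => θ₀ (.inr (.inr (.inl e))))
      (realize S.D fun e => θ₀ (.inr (.inr (.inr e)))) = Matrix.of E := by
    ext (i | i) (j | j)
    · by_cases h : S.A i j
      · simp [realize, h, θ₀]
      · have hij : i ≠ j := fun hij => h (hij ▸ N.self_loop i)
        simp [realize, h, hE (.inl i) (.inl j) h, hij]
    · by_cases h : S.B i j
      · simp [realize, h, θ₀]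
      · simp [realize, h, hE (.inl i) (.inr j) h]
    · by_cases h : S.C i j
      · simp [realize, h, θ₀]
      · simp [realize, h, hE (.inr i) (.inl j) h]
    · simp [realize, θ₀, hE (.inr i) (.inr j) id]
  have hM₀ : M θ₀ = 1 := by
    simp only [M, hblocks]
    ext r c
    simp [E, Matrix.one_apply, hg.eq_iff]
  have hentry : ∀ r c, ∃ q : MvPolynomial S.Parameter ℝ,
      ∀ θ, MvPolynomial.eval θ q = M θ r c := by
    intro r c
    have hreal : ∀ {I J : Type} (P : Matrix I J Prop) (f : FreeEntry P → S.Parameter) (i : I)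
        (j : J), ∃ q : MvPolynomial S.Parameter ℝ,
          ∀ θ, MvPolynomial.eval θ q = realize P (fun e => θ (f e)) i j := by
      intro I J P f i j
      by_cases h : P i j
      · exact ⟨MvPolynomial.X (f ⟨(i, j), h⟩), fun θ => by simp [realize, h]⟩
      · exact ⟨0, fun θ => by simp [realize, h]⟩
    rcases hr : g r with i | i <;> rcases c with j | j
    · obtain ⟨q, hq⟩ := hreal S.A (fun e => .inl e) i j
      exact ⟨MvPolynomial.C ((1 : Matrix (Fin n) (Fin n) ℝ) i j) - q, fun θ => by
        simp [M, hr, hq]⟩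
    · obtain ⟨q, hq⟩ := hreal S.B (fun e => .inr (.inl e)) i j
      exact ⟨-q, fun θ => by simp [M, hr, hq]⟩
    · obtain ⟨q, hq⟩ := hreal S.C (fun e => .inr (.inr (.inl e))) i j
      exact ⟨q, fun θ => by simp [M, hr, hq]⟩
    · obtain ⟨q, hq⟩ := hreal S.D (fun e => .inr (.inr (.inr e))) i j
      exact ⟨q, fun θ => by simp [M, hr, hq]⟩
  filter_upwards [ae_det_ne_zero_of_polynomial_entries M hentry θ₀ (by rw [hM₀]; simp)] with θ hθ
  exact leftInvertible_of_det_ne_zero _ _ _ _ g hθ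

/-- If `K` contains `x_i` and no agent of `K` outside `T` is observed or has an edge to an agent
outside `K ∪ T`, then `T` is a vertex separator of `(x_i, o)`. -/
theorem isVertexSeparator_of_invariant {i : Fin n} (hi : N.Unobserved i) (T : Finset (Fin n))
    (hiT : i ∉ T) (K : Set (Fin n)) (hiK : i ∈ K)
    (hobs : ∀ v ∈ K, v ∉ T → N.Unobserved v)
    (hstep : ∀ v ∈ K, v ∉ T → ∀ w, N.comm v w → w ∉ T → w ∈ K) :
    IsVertexSeparator N.collapsedGraph (some i) none (T.map Function.Embedding.some) := by
  refine ⟨by simp, fun ⟨j, hj⟩ => hi j hj, by simpa using hiT, by simp, ?_⟩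
  -- Induction along the path: it stays in `K` until it meets `T`, and it cannot step to `o` from
  -- `K` outside `T`.
  have key : ∀ (l : List (Option (Fin n))) (v : Fin n), v ∈ K → v ∉ T →
      (some v :: l).IsChain N.collapsedGraph.Adj → (some v :: l).getLast? = some none →
      ∃ w ∈ l, w ∈ T.map Function.Embedding.some := by
    intro l
    induction l with
    | nil => intro v _ _ _ h; simp at h
    | cons a l ih =>
      intro v hv hvT hc hlast
      rw [List.isChain_cons_cons] at hc
      rcases a with _ | w
      · obtain ⟨j, hj⟩ := hc.1
        exact absurd hj (hobs v hv hvT j)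
      · by_cases hw : w ∈ T
        · exact ⟨some w, by simp, by simpa using hw⟩
        · obtain ⟨z, hz, hzT⟩ := ih w (hstep v hv hvT w hc.1 hw) hw hc.2
            (by simpa [List.getLast?_cons_cons] using hlast)
          exact ⟨z, List.mem_cons_of_mem _ hz, hzT⟩
  rintro l ⟨hhead, hlast, hchain⟩
  obtain ⟨l', rfl⟩ : ∃ l', l = some i :: l' := by
    cases l with
    | nil => simp at hhead
    | cons a l' => exact ⟨l', by simpa using hhead⟩
  obtain ⟨w, hw, hwT⟩ := key l' i hiK hiT hchain hlast
  exact ⟨w, List.mem_cons_of_mem _ hw, hwT⟩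

/-- By Hall's theorem: a set of columns with too few neighbouring rows yields a separator that is
too small. -/
theorem exists_matching {p : ℕ} (hsep : ∀ i : Fin n, N.Unobserved i →
      ∀ S : Finset (Option (Fin n)),
        IsVertexSeparator N.collapsedGraph (some i) none S → p ≤ S.card)
    (F : Finset (Fin n)) (hF : F.card ≤ p) :
    ∃ g : Fin n ⊕ F → Fin n ⊕ Fin m, Function.Injective g ∧
      ∀ c, N.pencilPattern F c (g c) := by
  classical
  have hall := (Finset.all_card_le_biUnion_card_iff_exists_injective
    fun c : Fin n ⊕ F => Finset.univ.filter fun r => N.pencilPattern F c r).mp ?_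
  · obtain ⟨g, hg, hgm⟩ := hall
    exact ⟨g, hg, fun c => (Finset.mem_filter.mp (hgm c)).2⟩
  intro s
  by_contra hlt
  rw [not_le] at hlt
  let K : Finset (Fin n) := s.toLeft
  let W : Finset (Fin n) := s.toRight.map (Function.Embedding.subtype _)
  let R : Finset (Fin n) := Finset.univ.filter fun w => (∃ v ∈ K, N.comm v w) ∨ w ∈ W
  let O : Finset (Fin n) := K.filter fun v => ¬ N.Unobserved v
  -- `T` consists of the exits from `K` and its observed agents. Self loops give `K ⊆ R`, so `|T| ≤
  -- |R| - |K| + |O|`, and the violated Hall inequality makes this less than `|W|`.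
  let T : Finset (Fin n) := (R \ K) ∪ O
  have hs : s.card = K.card + W.card := by
    simp [K, W, Finset.card_toLeft_add_card_toRight]
  have hKR : K ⊆ R := fun v hv => by
    simp only [R, Finset.mem_filter, Finset.mem_univ, true_and]
    exact .inl ⟨v, hv, N.self_loop v⟩
  have hWR : W ⊆ R := fun v hv => by
    simp only [R, Finset.mem_filter, Finset.mem_univ, true_and]
    exact .inr hv
  have hRO : R.card + O.card ≤
      (s.biUnion fun c => Finset.univ.filter fun r => N.pencilPattern F c r).card := by
    have hex : ∀ v ∈ O, ∃ j, N.obs v j := fun v hv => by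
      simpa [Unobserved] using (Finset.mem_filter.mp hv).2
    choose o ho using hex
    let o' : O → Fin m := fun v => o v v.2
    have hinj : Function.Injective o' := fun v w h =>
      Subtype.ext ((N.obs_unique (o' v)).unique (ho v v.2) (h ▸ ho w w.2))
    rw [← Finset.card_attach (s := O), ← Finset.card_image_of_injective _ hinj,
      ← Finset.card_disjSum]
    refine Finset.card_le_card fun r hr => ?_
    rw [Finset.mem_biUnion]
    rcases r with w | j
    · rw [Finset.inl_mem_disjSum] at hr
      rcases (Finset.mem_filter.mp hr).2 with ⟨v, hv, hvw⟩ | hw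
      · exact ⟨.inl v, Finset.mem_toLeft.mp hv, Finset.mem_filter.mpr ⟨Finset.mem_univ _, hvw⟩⟩
      · obtain ⟨f, hf, rfl⟩ := Finset.mem_map.mp hw
        exact ⟨.inr f, Finset.mem_toRight.mp hf, Finset.mem_filter.mpr ⟨Finset.mem_univ _, rfl⟩⟩
    · rw [Finset.inr_mem_disjSum] at hr
      obtain ⟨v, -, rfl⟩ := Finset.mem_image.mp hr
      exact ⟨.inl v, Finset.mem_toLeft.mp (Finset.mem_filter.mp v.2).1,
        Finset.mem_filter.mpr ⟨Finset.mem_univ _, ho v v.2⟩⟩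
  have hT : T.card < W.card := by
    have h1 : T.card ≤ (R \ K).card + O.card := Finset.card_union_le _ _
    have h2 := Finset.card_sdiff_add_card_eq_card hKR
    omega
  have hWF : W.card ≤ F.card := by
    refine Finset.card_le_card fun v hv => ?_
    obtain ⟨f, _, rfl⟩ := Finset.mem_map.mp hv
    exact f.2
  -- An attacked agent outside `T` lies in `K` and is unobserved, and `T` separates it from `o`
  -- although `|T| < |W| ≤ p`.
  obtain ⟨f, hfW, hfT⟩ := Finset.exists_mem_notMem_of_card_lt_card hT
  have hmemK : ∀ v ∈ R, v ∉ T → v ∈ K := fun v hv hvT => by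
    by_contra h
    exact hvT (Finset.mem_union_left _ (Finset.mem_sdiff.mpr ⟨hv, h⟩))
  have hobs : ∀ v ∈ K, v ∉ T → N.Unobserved v := fun v hv hvT => by
    by_contra h
    exact hvT (Finset.mem_union_right _ (Finset.mem_filter.mpr ⟨hv, h⟩))
  have hfK := hmemK f (hWR hfW) hfT
  have := hsep f (hobs f hfK hfT) _ (N.isVertexSeparator_of_invariant (hobs f hfK hfT) T hfT
    (K : Set (Fin n)) hfK hobs fun v hv hvT w hvw hwT =>
      hmemK w (Finset.mem_filter.mpr ⟨Finset.mem_univ _, .inl ⟨v, hv, hvw⟩⟩) hwT)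
  rw [Finset.card_map] at this
  omega

/-! ### Necessity -/

/-- The agents reachable from `x_i` by paths avoiding `T`. -/
def reachableAvoiding (i : Fin n) (T : Finset (Fin n)) : Set (Fin n) :=
  {v | ∃ l : List (Fin n), (l ++ [v]).head? = some i ∧ (l ++ [v]).IsChain N.comm ∧
    ∀ w ∈ l ++ [v], w ∉ T}

theorem unobserved_of_mem_reachableAvoiding {i : Fin n} {T : Finset (Fin n)}
    (hT : ∀ l, IsDipath N.collapsedGraph (some i) none l → ∃ v ∈ l,
      v ∈ T.map Function.Embedding.some) {v : Fin n} (hv : v ∈ N.reachableAvoiding i T) :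
    N.Unobserved v := by
  obtain ⟨l, hhead, hchain, havoid⟩ := hv
  intro j hj
  have hpath : IsDipath N.collapsedGraph (some i) none ((l ++ [v]).map some ++ [none]) := by
    refine ⟨?_, by simp, ?_⟩
    · rw [List.head?_append, List.head?_map, hhead, Option.map_some, Option.some_or]
    · rw [List.isChain_append, List.isChain_map]
      refine ⟨hchain, by simp, fun a ha b hb => ?_⟩
      simp only [List.map_append, List.map_cons, List.map_nil, List.getLast?_append_cons,
        List.getLast?_singleton, Option.mem_some_iff, List.head?_cons] at ha hb
      subst ha hb
      exact ⟨j, hj⟩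
  obtain ⟨w, hw, hwT⟩ := hT _ hpath
  rcases List.mem_append.mp hw with hw | hw
  · obtain ⟨z, hz, rfl⟩ := List.mem_map.mp hw
    exact havoid z hz (by simpa using hwT)
  · rw [List.mem_singleton.mp hw] at hwT
    simp at hwT

theorem mem_reachableAvoiding_of_comm {i v w : Fin n} {T : Finset (Fin n)}
    (hv : v ∈ N.reachableAvoiding i T) (hvw : N.comm v w) (hw : w ∉ T) :
    w ∈ N.reachableAvoiding i T := by
  obtain ⟨l, hhead, hchain, havoid⟩ := hv
  refine ⟨l ++ [v], ?_, ?_, ?_⟩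
  · rw [List.head?_append, hhead]
    rfl
  · rw [List.isChain_append]
    refine ⟨hchain, by simp, fun a ha b hb => ?_⟩
    simp only [List.getLast?_append_cons, List.getLast?_singleton, Option.mem_some_iff,
      List.head?_cons] at ha hb
    subst ha hb
    exact hvw
  · intro z hz
    rcases List.mem_append.mp hz with hz | hz
    · exact havoid z hz
    · rwa [List.mem_singleton.mp hz]

/-- An attacker who controls `x_i` and a separator `T` of `(x_i, o)` excites `x_i` and cancels
everything that reaches `T`, so that no output ever changes. -/
theorem not_realizationLeftInvertible {i : Fin n} {T : Finset (Fin n)} (hi : i ∉ T)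
    (hT : ∀ l, IsDipath N.collapsedGraph (some i) none l → ∃ v ∈ l,
      v ∈ T.map Function.Embedding.some)
    (θ : (N.attackedSystem (insert i T)).Parameter → ℝ) :
    ¬ (N.attackedSystem (insert i T)).RealizationLeftInvertible θ := by
  classical
  unfold StructuralSystem.RealizationLeftInvertible
  set A := realize (N.attackedSystem (insert i T)).A fun e => θ (.inl e) with hA
  set B := realize (N.attackedSystem (insert i T)).B fun e => θ (.inr (.inl e)) with hB
  set C := realize (N.attackedSystem (insert i T)).C fun e => θ (.inr (.inr (.inl e))) with hC
  set D := realize (N.attackedSystem (insert i T)).D fun e => θ (.inr (.inr (.inr e))) with hD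
  have hD0 : D = 0 := by
    ext a b
    simp [hD, realize, attackedSystem]
  have hA0 : ∀ a b, ¬ N.comm b a → A a b = 0 := fun a b h => by
    simp [hA, realize, attackedSystem, h]
  have hC0 : ∀ a b, ¬ N.obs b a → C a b = 0 := fun a b h => by
    simp [hC, realize, attackedSystem, h]
  have hB0 : ∀ (a : Fin n) (b : ↥(insert i T)), a ≠ b → B a b = 0 := fun a b h => by
    simp [hB, realize, attackedSystem, h]
  have hBin : ∀ (w : ↥(insert i T) → ℝ) (b : ↥(insert i T)),
      (B *ᵥ w) b = B b b * w b := fun w b => by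
    rw [Matrix.mulVec, dotProduct]
    refine Finset.sum_eq_single b (fun c _ hc => ?_)
      fun h => absurd (Finset.mem_univ b) h
    rw [hB0 b c (fun h => hc (Subtype.ext h.symm)), zero_mul]
  have hBout : ∀ (w : ↥(insert i T) → ℝ) (a : Fin n), a ∉ insert i T →
      (B *ᵥ w) a = 0 := fun w a ha => by
    rw [Matrix.mulVec, dotProduct]
    refine Finset.sum_eq_zero fun c _ => ?_
    rw [hB0 a c (fun h => ha (h ▸ c.2)), zero_mul]
  intro hinv
  -- An input with zero gain is invisible, which settles degenerate parameters and permits division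
  -- by the gains below.
  by_cases hb : ∃ b : ↥(insert i T), B b b = 0
  · obtain ⟨b, hb⟩ := hb
    have hBw : B *ᵥ (Pi.single b 1) = 0 := by
      funext a
      by_cases hab : a = b
      · subst hab
        rw [hBin, hb, zero_mul]
        rfl
      · simp [hB0 a b hab]
    have := congrFun (hinv (fun _ => 0) (fun _ => Pi.single b 1) rfl
      (fun k => by rw [hBw, Matrix.mulVec_zero, add_zero]) (fun k => by
        rw [hD0, Matrix.zero_mulVec, Matrix.mulVec_zero, add_zero]) 0) b
    simp at this
  · push Not at hb
    -- State feedback: a unit pulse at `x_i` at time `0`, and on `T` the input that cancels the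
    -- incoming `A *ᵥ z`.
    let c : ℕ → (Fin n → ℝ) → ↥(insert i T) → ℝ := fun k z b =>
      if (b : Fin n) = i then (if k = 0 then 1 else 0) else -(A *ᵥ z) b / B b b
    let x : ℕ → Fin n → ℝ := fun k => Nat.rec 0 (fun k z => A *ᵥ z + B *ᵥ c k z) k
    have hsupp : ∀ k, ∀ v ∉ N.reachableAvoiding i T, x k v = 0 := by
      intro k
      induction k with
      | zero => exact fun v _ => rfl
      | succ k ih =>
        intro v hv
        change (A *ᵥ x k) v + (B *ᵥ c k (x k)) v = 0
        have hvi : v ≠ i := by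
          rintro rfl
          exact hv ⟨[], by simp, by simp, by simpa using hi⟩
        by_cases hvT : v ∈ T
        · have hv' : v ∈ insert i T := Finset.mem_insert_of_mem hvT
          have h := hBin (c k (x k)) ⟨v, hv'⟩
          have hne := hb ⟨v, hv'⟩
          simp only [c, hvi, if_false] at h
          rw [h]
          simp only at hne
          field_simp
          ring
        · rw [hBout _ v (by simp [hvi, hvT]), add_zero, Matrix.mulVec, dotProduct]
          refine Finset.sum_eq_zero fun w _ => ?_
          by_cases hw : w ∈ N.reachableAvoiding i T
          · rw [hA0 v w fun hwv => hv (N.mem_reachableAvoiding_of_comm hw hwv hvT), zero_mul]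
          · rw [ih w hw, mul_zero]
    have := congrFun (hinv x (fun k => c k (x k)) rfl (fun k => rfl) (fun k => by
      rw [hD0, Matrix.zero_mulVec, add_zero]
      funext j
      rw [Matrix.mulVec, dotProduct]
      refine Finset.sum_eq_zero fun v _ => ?_
      by_cases hv : v ∈ N.reachableAvoiding i T
      · rw [hC0 j v (N.unobserved_of_mem_reachableAvoiding hT hv j), zero_mul]
      · rw [hsupp k v hv, mul_zero]) 0) ⟨i, Finset.mem_insert_self i T⟩
    simp [c] at this

end Network

theorem mainTheorem2 {n m p : ℕ} (N : Network n m) (hpm : p ≤ m) :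
    (∀ F ∈ feasibleStateAttacks n p, (N.attackedSystem F).StructurallyLeftInvertible) ↔
      ∀ i : Fin n, N.Unobserved i →
        ∀ S : Finset (Option (Fin n)),
          IsVertexSeparator N.collapsedGraph (some i) none S → p ≤ S.card := by
  classical
  constructor
  · rintro h i - S ⟨-, -, hiS, hoS, hS⟩
    by_contra! hlt
    obtain ⟨T, rfl⟩ : ∃ T : Finset (Fin n), S = T.map Function.Embedding.some := by
      refine ⟨S.eraseNone, ?_⟩
      rw [Finset.map_some_eraseNone, Finset.erase_eq_of_notMem hoS]
    have hiT : i ∉ T := by simpa using hiS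
    rw [Finset.card_map] at hlt
    have hae := h (insert i T) (by
      change (insert i T).card ≤ p
      rw [Finset.card_insert_of_notMem hiT]
      omega)
    -- Lebesgue measure is nonzero, so one good parameter exists, and even one is contradictory.
    obtain ⟨θ, hθ⟩ := hae.exists
    exact N.not_realizationLeftInvertible hiT hS θ hθ
  · intro h F hF
    obtain ⟨g, hg, hpat⟩ := N.exists_matching h F hF
    exact N.structurallyLeftInvertible_of_matching F g hg hpat
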